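/- Let $\tau\in i\mathbb{R}_{>0}$ and write $q^u=e^{2\pi i\tau u}$ for $u\in\mathbb{C}$, so that $0<q<1$. Put $$\Gamma_{2\tau}(x)=\frac{q^{-x^2/8}}{\bigl(-q^{x+1};q^2\bigr)_\infty},\qquad (b;p)_\infty=\prod_{j\ge 0}(1-bp^j).$$ Let $\widetilde{\mathcal U}_q$ be the unital complex algebra generated by $K^{\pm1},X^{+},X^{-}$ and $\widehat{x}$ ($x\in\mathbb{C}$) with relations $KK^{-1}=K^{-1}K=1$, $KX^{\pm}=q^{\pm1}X^{\pm}K$, $X^+X^--X^-X^+=(K^2-K^{-2})/(q-q^{-1})$, $\widehat{0}=1$, $\widehat{x+y}=\widehat{x}\,\widehat{y}$, $\widehat{x}K^{\pm1}=K^{\pm1}\widehat{x}$, $\widehat{x}X^{\pm}=q^{\pm x}X^{\pm}\widehat{x}$. For $\lambda\in\mathbb{C}$ it acts on meromorphic functions on $\mathbb{C}$ through the representation $\pi_\lambda$ determined by $$(\pi_\lambda(X^{\pm})f)(z)=q^{\pm z}\,\frac{q^{-\frac12-i\lambda}f(z\mp1)-q^{\frac12+i\lambda}f(z\pm1)}{q^{-1}-q},\qquad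 (\pi_\lambda(K^{\pm1})f)(z)=f(z\pm1),\qquad (\pi_\lambda(\widehat{x})f)(z)=f(z+x).$$ Put $\langle f,g\rangle=\int_0^1 f(y/\tau)\overline{g(y/\tau)}\,dy$ and $$f_\lambda(z;\alpha,\rho)=\frac{\Gamma_{2\tau}\bigl(-1-\frac1{2\tau}+\alpha+\rho-i\lambda+z\bigr)\,\Gamma_{2\tau}\bigl(-\frac1{2\tau}+\rho-i\lambda-z\bigr)}{\Gamma_{2\tau}\bigl(1-\frac1{2\tau}+\alpha+\rho+i\lambda-z\bigr)\,\Gamma_{2\tau}\bigl(-\frac1{2\tau}+\rho+i\lambda+z\bigr)}.$$ Let $\lambda\in\mathbb{R}$, let $\alpha,\beta$ be positive even integers, let $\rho,\sigma\in\mathbb{R}$ with $\rho,\sigma\ge3$, and for $|\mathrm{Re}(x)|\le 2$ put $$\phi_\lambda(x)=\bigl\langle\pi_\lambda(\widehat{x}K)f_\lambda(\cdot;\beta,\sigma),\,f_\lambda(\cdot;\alpha,\rho)\bigr\rangle .$$ (1) For all $x\in\mathbb{C}$ with $|\mathrm{Re}(x)|\le2$, $$\begin{aligned}\phi_\lambda(x)=\int_0^1&\frac{\Gamma_{2\tau}\bigl(-\frac1{2\tau}+\beta+\sigma-i\lambda+x+\frac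 y\tau\bigr)\Gamma_{2\tau}\bigl(-1-\frac1{2\tau}+\sigma-i\lambda-x-\frac y\tau\bigr)}{\Gamma_{2\tau}\bigl(-\frac1{2\tau}+\beta+\sigma+i\lambda-x-\frac y\tau\bigr)\Gamma_{2\tau}\bigl(1-\frac1{2\tau}+\sigma+i\lambda+x+\frac y\tau\bigr)}\\&\times\frac{\Gamma_{2\tau}\bigl(-1+\frac1{2\tau}+\alpha+\rho+i\lambda-\frac y\tau\bigr)\Gamma_{2\tau}\bigl(\frac1{2\tau}+\rho+i\lambda+\frac y\tau\bigr)}{\Gamma_{2\tau}\bigl(1+\frac1{2\tau}+\alpha+\rho-i\lambda+\frac y\tau\bigr)\Gamma_{2\tau}\bigl(\frac1{2\tau}+\rho-i\lambda-\frac y\tau\bigr)}\,dy,\end{aligned}$$ and the integrand is integrable on $[0,1]$. (2) Let $(a,b,c,d)=(1+\rho+\sigma,\;1-\rho+\sigma,\;1+\alpha+\rho-\beta-\sigma,\;1-\alpha-\rho-\beta-\sigma)$ and $$A(x)=\frac{(1-q^{a+x})(1-q^{b+x})(1-q^{c+x})(1-q^{d+x})}{(1-q^{2x})(1-q^{2+2x})},\qquad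 C(x)=-A(x)-A(-x),$$ $$B(x)=q^{-\beta}\frac{(1-q^{a+x})(1-q^{2-a+x})(1-q^{b+x})(1-q^{2-b+x})}{(1-q^{2x})(1-q^{2+2x})},\qquad D(x)=q^{-\beta}\frac{(1-q^{c-x})(1-q^{2-c-x})(1-q^{d-x})(1-q^{2-d-x})}{(1-q^{-2x})(1-q^{2-2x})}.$$ Then for every $x\in i\mathbb{R}$ with $q^{2x}\ne1$ (that is, wherever the coefficients are defined), the gauged Askey–Wilson equation holds: $$B(x)\phi_\lambda(x+2)+C(x)\phi_\lambda(x)+D(x)\phi_\lambda(x-2)=E(\lambda)\phi_\lambda(x),\qquad E(\lambda)=-1-q^{2-2\beta}+q^{1-\beta}\bigl(q^{2i\lambda}+q^{-2i\lambda}\bigr).$$ -/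

import Mathlib

noncomputable section

namespace AskeyWilson

/-! ### The `q`-gamma type function -/

/-- `q_τ^u = exp(2π i τ u)`. -/
def qPow (τ u : ℂ) : ℂ := Complex.exp (2 * Real.pi * Complex.I * τ * u)

/-- The infinite `q`-shifted factorial `(b; q)_∞ = ∏_{n ≥ 0} (1 - b q^n)`. -/
def qPochhammer (b q : ℂ) : ℂ := ∏' n : ℕ, (1 - b * q ^ n)

/-- `Γ_τ(x) = q_τ^{-x²/16} / (-q_τ^{(x+1)/2}; q_τ)_∞`. -/
def qGamma (τ x : ℂ) : ℂ :=
  qPow τ (-(x ^ 2) / 16) / qPochhammer (-qPow τ ((x + 1) / 2)) (qPow τ 1)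

theorem qPow_add (τ u v : ℂ) : qPow τ (u + v) = qPow τ u * qPow τ v := by
  simp only [qPow, mul_add, Complex.exp_add]

theorem qPow_zero (τ : ℂ) : qPow τ 0 = 1 := by simp [qPow]

theorem qPow_ne_zero (τ u : ℂ) : qPow τ u ≠ 0 := Complex.exp_ne_zero _

@[fun_prop]
theorem differentiable_qPow (τ : ℂ) : Differentiable ℂ (qPow τ) := by
  unfold qPow; fun_prop

theorem norm_qPow_one_lt {τ : ℂ} (hτ : 0 < τ.im) : ‖qPow τ 1‖ < 1 := by
  rw [qPow, Complex.norm_exp, Real.exp_lt_one_iff]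
  simp
  positivity

theorem differentiable_qPochhammer {q : ℂ} (hq : ‖q‖ < 1) :
    Differentiable ℂ (fun b => qPochhammer b q) := by
  have h : HasProdLocallyUniformlyOn (fun (n : ℕ) (b : ℂ) => 1 + -(b * q ^ n))
      (fun b => ∏' n : ℕ, (1 + -(b * q ^ n))) Set.univ := by
    apply hasProdLocallyUniformlyOn_of_forall_compact isOpen_univ
    intro C _ hC
    obtain ⟨M, hM⟩ := hC.isBounded.exists_norm_le
    refine ((summable_geometric_of_lt_one (norm_nonneg q) hq).mul_left M).hasProdUniformlyOn_nat_one_add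
      hC (.of_forall fun n x hx => ?_) (fun n => by fun_prop)
    rw [norm_neg, norm_mul, norm_pow]
    exact mul_le_mul_of_nonneg_right (hM x hx) (by positivity)
  rw [← differentiableOn_univ]
  have := h.differentiableOn (.of_forall fun _ => by
    simpa [Finset.prod_fn] using DifferentiableOn.finsetProd (fun _ _ => by fun_prop)) isOpen_univ
  simpa only [qPochhammer, sub_eq_add_neg] using this

theorem meromorphic_of_differentiable {f : ℂ → ℂ} (hf : Differentiable ℂ f) : Meromorphic f :=
  fun z => (hf.analyticAt z).meromorphicAt

theorem meromorphic_qGamma_comp {τ : ℂ} (hτ : 0 < τ.im) {h : ℂ → ℂ} (hh : Differentiable ℂ h) :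
    Meromorphic (fun z => qGamma τ (h z)) := by
  unfold qGamma
  refine Meromorphic.fun_div (meromorphic_of_differentiable ?_) (meromorphic_of_differentiable ?_)
  · fun_prop
  · exact (differentiable_qPochhammer (norm_qPow_one_lt hτ)).comp
      (g := fun b => qPochhammer b (qPow τ 1)) (by fun_prop)

/-! ### The extended quantum group -/

/-- Generators of the extended algebra: `K`, `K⁻¹`, `X⁺`, `X⁻` and `x̂` for `x ∈ ℂ`. -/
inductive Gen : Type
  | K : Gen
  | Kinv : Gen
  | Xplus : Gen
  | Xminus : Gen
  | hat : ℂ → Gen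

open Gen FreeAlgebra in
/-- The defining relations: those of `U_q`, those of the group algebra of `(ℂ, +)`, and
`x̂ X = κ_x(X) x̂`, where `κ_x(K^{±1}) = K^{±1}` and `κ_x(X^±) = q^{±x} X^±`. -/
inductive Rel (τ : ℂ) : FreeAlgebra ℂ Gen → FreeAlgebra ℂ Gen → Prop
  | K_Kinv : Rel τ (ι ℂ K * ι ℂ Kinv) 1
  | Kinv_K : Rel τ (ι ℂ Kinv * ι ℂ K) 1
  | K_Xplus : Rel τ (ι ℂ K * ι ℂ Xplus) (qPow τ 1 • (ι ℂ Xplus * ι ℂ K))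
  | K_Xminus : Rel τ (ι ℂ K * ι ℂ Xminus) (qPow τ (-1) • (ι ℂ Xminus * ι ℂ K))
  | comm : Rel τ (ι ℂ Xplus * ι ℂ Xminus - ι ℂ Xminus * ι ℂ Xplus)
      ((qPow τ 1 - qPow τ (-1))⁻¹ • (ι ℂ K ^ 2 - ι ℂ Kinv ^ 2))
  | hat_zero : Rel τ (ι ℂ (hat 0)) 1
  | hat_add (x y : ℂ) : Rel τ (ι ℂ (hat (x + y))) (ι ℂ (hat x) * ι ℂ (hat y))
  | hat_K (x : ℂ) : Rel τ (ι ℂ (hat x) * ι ℂ K) (ι ℂ K * ι ℂ (hat x))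
  | hat_Kinv (x : ℂ) : Rel τ (ι ℂ (hat x) * ι ℂ Kinv) (ι ℂ Kinv * ι ℂ (hat x))
  | hat_Xplus (x : ℂ) : Rel τ (ι ℂ (hat x) * ι ℂ Xplus) (qPow τ x • (ι ℂ Xplus * ι ℂ (hat x)))
  | hat_Xminus (x : ℂ) :
      Rel τ (ι ℂ (hat x) * ι ℂ Xminus) (qPow τ (-x) • (ι ℂ Xminus * ι ℂ (hat x)))

/-- The extended quantum group: the smash product of `U_q` with the group algebra of `(ℂ, +)`,
given by generators and relations. -/
abbrev ExtendedUq (τ : ℂ) : Type := RingQuot (Rel τ)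

/-- The class of a generator in the extended quantum group. -/
def gen (τ : ℂ) (g : Gen) : ExtendedUq τ := RingQuot.mkAlgHom ℂ (Rel τ) (FreeAlgebra.ι ℂ g)

/-! ### The representation `π_λ` on meromorphic functions -/

/-- The space of meromorphic functions on `ℂ`. -/
def Mero : Submodule ℂ (ℂ → ℂ) where
  carrier := {f | Meromorphic f}
  add_mem' hf hg := hf.add hg
  zero_mem' := Meromorphic.const 0
  smul_mem' c _ hf := hf.const_smul c

theorem meromorphic_shift {f : ℂ → ℂ} (hf : Meromorphic f) (x : ℂ) :
    Meromorphic (fun z => f (z + x)) := by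
  intro z
  exact (hf (z + x)).comp_analyticAt (g := fun z => z + x) (by fun_prop)

/-- The operator `f ↦ f(· + x)`. -/
def shiftOp (x : ℂ) : Module.End ℂ Mero where
  toFun f := ⟨fun z => f.1 (z + x), meromorphic_shift f.2 x⟩
  map_add' _ _ := rfl
  map_smul' _ _ := rfl

/-- The operator
`f ↦ q^{sz} (q^{-1/2-iλ} f(z-s) - q^{1/2+iλ} f(z+s)) / (q⁻¹ - q)`; it is `π_λ(X^±)` for `s = ±1`. -/
def XOp (τ lam s : ℂ) : Module.End ℂ Mero where
  toFun f := ⟨fun z => qPow τ (s * z) *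
      ((qPow τ (-(1 / 2) - Complex.I * lam) * f.1 (z - s) -
        qPow τ (1 / 2 + Complex.I * lam) * f.1 (z + s)) / (qPow τ (-1) - qPow τ 1)), by
    refine Meromorphic.fun_mul (meromorphic_of_differentiable (by fun_prop))
      (Meromorphic.fun_div (Meromorphic.fun_sub ?_ ?_) (Meromorphic.const _))
    · exact Meromorphic.fun_mul (Meromorphic.const _)
        (by simpa only [sub_eq_add_neg] using meromorphic_shift f.2 (-s))
    · exact Meromorphic.fun_mul (Meromorphic.const _) (meromorphic_shift f.2 s)⟩
  map_add' f g := by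
    ext z
    simp only [Submodule.coe_add, Pi.add_apply]
    ring
  map_smul' c f := by
    ext z
    simp only [Submodule.coe_smul, Pi.smul_apply, smul_eq_mul, RingHom.id_apply]
    ring

/-- The action of the generators under `π_λ`. -/
def genAction (τ lam : ℂ) : Gen → Module.End ℂ Mero
  | .K => shiftOp 1
  | .Kinv => shiftOp (-1)
  | .Xplus => XOp τ lam 1
  | .Xminus => XOp τ lam (-1)
  | .hat x => shiftOp x

theorem genAction_rel (τ lam : ℂ) {a b : FreeAlgebra ℂ Gen} (h : Rel τ a b) :
    FreeAlgebra.lift ℂ (genAction τ lam) a = FreeAlgebra.lift ℂ (genAction τ lam) b := by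
  have hc : qPow τ (-(1 / 2) - Complex.I * lam) * qPow τ (1 / 2 + Complex.I * lam) = 1 := by
    rw [← qPow_add, ← qPow_zero τ]; congr 1; ring
  have hq : qPow τ (-1) * qPow τ 1 = 1 := by
    rw [← qPow_add, ← qPow_zero τ]; congr 1; ring
  cases h with
  | comm =>
    ext f z
    by_cases hd : qPow τ (-1) - qPow τ 1 = 0
    · have hd' : qPow τ 1 - qPow τ (-1) = 0 := by rw [← neg_sub, hd, neg_zero]
      simp [FreeAlgebra.lift_ι_apply, genAction, XOp, hd, hd']
    · have hd' : (qPow τ 1 - qPow τ (-1))⁻¹ = -(qPow τ (-1) - qPow τ 1)⁻¹ := by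
        rw [← neg_sub, inv_neg]
      have hz : qPow τ z * qPow τ (-z) = 1 := by
        rw [← qPow_add, ← qPow_zero τ]; congr 1; ring
      have e1 : z - 1 - -1 = z := by ring
      have e2 : z - 1 + -1 = z - 2 := by ring
      have e3 : z + 1 - -1 = z + 2 := by ring
      have e4 : z + 1 + -1 = z := by ring
      have e5 : z - -1 - 1 = z := by ring
      have e6 : z - -1 + 1 = z + 2 := by ring
      have e7 : z + -1 - 1 = z - 2 := by ring
      have e8 : z + -1 + 1 = z := by ring
      have e9 : z + 1 + 1 = z + 2 := by ring
      have e10 : z + -1 + -1 = z - 2 := by ring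
      have m1 : qPow τ (-1 * (z - 1)) = qPow τ (-z) * qPow τ 1 := by
        rw [← qPow_add]; congr 1; ring
      have m2 : qPow τ (-1 * (z + 1)) = qPow τ (-z) * qPow τ (-1) := by
        rw [← qPow_add]; congr 1; ring
      have m3 : qPow τ (1 * (z - -1)) = qPow τ z * qPow τ 1 := by
        rw [← qPow_add]; congr 1; ring
      have m4 : qPow τ (1 * (z + -1)) = qPow τ z * qPow τ (-1) := by
        rw [← qPow_add]; congr 1; ring
      simp only [map_sub, map_mul, map_smul, FreeAlgebra.lift_ι_apply, genAction, pow_two,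
        hd']
      change (XOp τ lam 1 (XOp τ lam (-1) f)).1 z - (XOp τ lam (-1) (XOp τ lam 1 f)).1 z =
        -(qPow τ (-1) - qPow τ 1)⁻¹ *
          ((shiftOp 1 (shiftOp 1 f)).1 z - (shiftOp (-1) (shiftOp (-1) f)).1 z)
      simp only [XOp, shiftOp, LinearMap.coe_mk, AddHom.coe_mk, e1, e2, e3, e4, e5, e6, e7, e8, e9,
        e10, m1, m2, m3, m4]
      rw [one_mul, neg_one_mul]
      generalize qPow τ z = Z at *
      generalize qPow τ (-z) = W at *
      generalize qPow τ (-(1 / 2) - Complex.I * lam) = c at *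
      generalize qPow τ (1 / 2 + Complex.I * lam) = d at *
      generalize qPow τ 1 = q at *
      generalize qPow τ (-1) = p at *
      field_simp
      grind
  | K_Kinv => ext f z; simp [FreeAlgebra.lift_ι_apply, genAction, shiftOp]
  | Kinv_K => ext f z; simp [FreeAlgebra.lift_ι_apply, genAction, shiftOp]
  | K_Xplus =>
    ext f z
    simp [FreeAlgebra.lift_ι_apply, genAction, shiftOp, XOp, qPow_add]
    ring_nf
  | K_Xminus =>
    ext f z
    simp [FreeAlgebra.lift_ι_apply, genAction, shiftOp, XOp, qPow_add]
    ring_nf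
  | hat_zero => ext f z; simp [FreeAlgebra.lift_ι_apply, genAction, shiftOp]
  | hat_add x y =>
    ext f z
    simp [FreeAlgebra.lift_ι_apply, genAction, shiftOp]
    ring_nf
  | hat_K x =>
    ext f z
    simp [FreeAlgebra.lift_ι_apply, genAction, shiftOp]
    ring_nf
  | hat_Kinv x =>
    ext f z
    simp [FreeAlgebra.lift_ι_apply, genAction, shiftOp]
    ring_nf
  | hat_Xplus x =>
    ext f z
    simp [FreeAlgebra.lift_ι_apply, genAction, shiftOp, XOp, qPow_add]
    ring_nf
  | hat_Xminus x =>
    ext f z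
    simp [FreeAlgebra.lift_ι_apply, genAction, shiftOp, XOp, qPow_add]
    ring_nf

/-- The representation `π_λ` of the extended quantum group on meromorphic functions. -/
def piRep (τ lam : ℂ) : ExtendedUq τ →ₐ[ℂ] Module.End ℂ Mero :=
  RingQuot.liftAlgHom ℂ ⟨FreeAlgebra.lift ℂ (genAction τ lam), fun _ _ h => genAction_rel τ lam h⟩

/-! ### Matrix coefficients -/

/-- The pairing `⟨f, g⟩ = ∫₀¹ f(y/τ) conj(g(y/τ)) dy`. -/
def pairing (τ : ℂ) (f g : Mero) : ℂ :=
  ∫ y in (0 : ℝ)..1, f.1 ((y : ℂ) / τ) * starRingEnd ℂ (g.1 ((y : ℂ) / τ))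

/-- The meromorphic function `f_λ(z; α, ρ)`. -/
def fLam (τ : UpperHalfPlane) (lam α ρ : ℂ) : Mero :=
  ⟨fun z =>
    (qGamma (2 * τ) (-1 - 1 / (2 * τ) + α + ρ - Complex.I * lam + z) *
      qGamma (2 * τ) (-(1 / (2 * τ)) + ρ - Complex.I * lam - z)) /
    (qGamma (2 * τ) (1 - 1 / (2 * τ) + α + ρ + Complex.I * lam - z) *
      qGamma (2 * τ) (-(1 / (2 * τ)) + ρ + Complex.I * lam + z)), by
    have h : 0 < (2 * (τ : ℂ)).im := by
      simpa using τ.im_pos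
    exact Meromorphic.fun_div
      (Meromorphic.fun_mul (meromorphic_qGamma_comp h (by fun_prop))
        (meromorphic_qGamma_comp h (by fun_prop)))
      (Meromorphic.fun_mul (meromorphic_qGamma_comp h (by fun_prop))
        (meromorphic_qGamma_comp h (by fun_prop)))⟩

/-- The matrix coefficient
`φ_λ(x; α, ρ, β, σ) = ⟨π_λ(x̂ K) f_λ(·; β, σ), f_λ(·; α, ρ)⟩`. -/
def phi (τ : UpperHalfPlane) (lam α ρ β σ : ℂ) (x : ℂ) : ℂ :=
  pairing τ (piRep τ lam (gen τ (Gen.hat x) * gen τ Gen.K) (fLam τ lam β σ)) (fLam τ lam α ρ)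

/-- The integrand of the explicit integral representation of `φ_λ(x)`. -/
def phiIntegrand (τ lam α ρ β σ x : ℂ) (y : ℝ) : ℂ :=
  (qGamma (2 * τ) (-(1 / (2 * τ)) + β + σ - Complex.I * lam + x + y / τ) *
      qGamma (2 * τ) (-1 - 1 / (2 * τ) + σ - Complex.I * lam - x - y / τ)) /
    (qGamma (2 * τ) (-(1 / (2 * τ)) + β + σ + Complex.I * lam - x - y / τ) *
      qGamma (2 * τ) (1 - 1 / (2 * τ) + σ + Complex.I * lam + x + y / τ)) *
  ((qGamma (2 * τ) (-1 + 1 / (2 * τ) + α + ρ + Complex.I * lam - y / τ) *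
      qGamma (2 * τ) (1 / (2 * τ) + ρ + Complex.I * lam + y / τ)) /
    (qGamma (2 * τ) (1 + 1 / (2 * τ) + α + ρ - Complex.I * lam + y / τ) *
      qGamma (2 * τ) (1 / (2 * τ) + ρ - Complex.I * lam - y / τ)))

/-! ### The gauged Askey–Wilson operator -/

/-- The coefficient `A(x; a, b, c, d)` of the Askey–Wilson operator. -/
def coeffA (τ a b c d x : ℂ) : ℂ :=
  (1 - qPow τ (a + x)) * (1 - qPow τ (b + x)) * (1 - qPow τ (c + x)) * (1 - qPow τ (d + x)) /
    ((1 - qPow τ (2 * x)) * (1 - qPow τ (2 + 2 * x)))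

/-- The Askey–Wilson parameter `a`. -/
def parA (ρ σ : ℂ) : ℂ := 1 + ρ + σ

/-- The Askey–Wilson parameter `b`. -/
def parB (ρ σ : ℂ) : ℂ := 1 - ρ + σ

/-- The Askey–Wilson parameter `c`. -/
def parC (α ρ β σ : ℂ) : ℂ := 1 + α + ρ - β - σ

/-- The Askey–Wilson parameter `d`. -/
def parD (α ρ β σ : ℂ) : ℂ := 1 - α - ρ - β - σ

/-- The coefficient `B(x)`. -/
def coeffB (τ ρ β σ x : ℂ) : ℂ :=
  qPow τ (-β) *
    ((1 - qPow τ (parA ρ σ + x)) * (1 - qPow τ (2 - parA ρ σ + x)) *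
      (1 - qPow τ (parB ρ σ + x)) * (1 - qPow τ (2 - parB ρ σ + x)) /
    ((1 - qPow τ (2 * x)) * (1 - qPow τ (2 + 2 * x))))

/-- The coefficient `C(x) = -A(x) - A(-x)`. -/
def coeffC (τ α ρ β σ x : ℂ) : ℂ :=
  -coeffA τ (parA ρ σ) (parB ρ σ) (parC α ρ β σ) (parD α ρ β σ) x -
    coeffA τ (parA ρ σ) (parB ρ σ) (parC α ρ β σ) (parD α ρ β σ) (-x)

/-- The coefficient `D(x)`. -/
def coeffD (τ α ρ β σ x : ℂ) : ℂ :=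
  qPow τ (-β) *
    ((1 - qPow τ (parC α ρ β σ - x)) * (1 - qPow τ (2 - parC α ρ β σ - x)) *
      (1 - qPow τ (parD α ρ β σ - x)) * (1 - qPow τ (2 - parD α ρ β σ - x)) /
    ((1 - qPow τ (-(2 * x))) * (1 - qPow τ (2 - 2 * x))))

/-- The gauged Askey–Wilson second order difference operator
`(𝓛 f)(x) = B(x) f(x+2) + C(x) f(x) + D(x) f(x-2)`. -/
def opL (τ α ρ β σ : ℂ) (f : ℂ → ℂ) (x : ℂ) : ℂ :=
  coeffB τ ρ β σ x * f (x + 2) + coeffC τ α ρ β σ x * f x + coeffD τ α ρ β σ x * f (x - 2)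

/-- The eigenvalue `E(λ) = -1 - q^{2-2β} + q^{1-β}(q^{2iλ} + q^{-2iλ})`. -/
def eigenE (τ lam β : ℂ) : ℂ :=
  -1 - qPow τ (2 - 2 * β) +
    qPow τ (1 - β) * (qPow τ (2 * Complex.I * lam) + qPow τ (-(2 * Complex.I * lam)))

end AskeyWilson

end

/-! The equation is proved by creative telescoping under the integral. With κ = 1/(2τ) and μ = iλ,
the integrand of φ(x) at z = y/τ is F(z)H(z), where F(z) = `gammaQuot` at x + 1 + z and H, the
analytic continuation of the conjugated factor, is a `gammaQuot` at -z with κ and μ negated.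
Replacing x by x ± 2 only translates F by ± 2. The functional equation of Γ writes `gammaQuot` at w
+ 1 and at w - 1 as trigonometric factors times one common function `gammaCore` at w
(`gammaQuot_add_one`, `gammaQuot_sub_one`).

Hence the integrand of (𝓛 - E)φ is F, F(· ± 2) and H with rational coefficients in q^z, and it
equals T(z + 1) - T(z - 1) for an explicit `telescoper` T (`telescoper_sub`). T is the product of
the two cores, two trigonometric factors and a Laurent polynomial `cert` in y = q^z of degrees -1,
0, 1. Its coefficients are such that B·(factor) - cert·(factor) and D·(factor) + cert·(factor) are
divisible by the factors relating F to the cores. The y-dependent parts of the two quotients cancel,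
and their constant parts add up to E - C (`certP_add_certQ`).

Finally, T is holomorphic on |Re z| ≤ 1 and, because α and β are even, has period 1/τ. Cauchy's
theorem on a period rectangle then gives T(y/τ + 1) and T(y/τ - 1) the same integral
(`integral_shift_eq`), so (𝓛 - E)φ = 0. -/

noncomputable section

namespace AskeyWilson

/-! ### The rational certificate, in the variables X = q^x, L = q^μ, y = q^z, R = q^ρ, S = q^σ, T =
q^(β+σ), M = q^(α+ρ), b = q^β. -/

section Certificate

variable {k : Type*} [Field k]

/-- The coefficient `B` of the gauged Askey–Wilson operator in multiplicative variables. -/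
def ratB (q b X S R : k) : k :=
  b⁻¹ * ((1 - q * X * R * S) * (1 - q * X / (R * S)) * (1 - q * X * S / R) *
    (1 - q * X * R / S) / ((1 - X ^ 2) * (1 - q ^ 2 * X ^ 2)))

/-- The coefficient `D` of the gauged Askey–Wilson operator in multiplicative variables. -/
def ratD (q b X T M : k) : k :=
  b⁻¹ * ((1 - q / X * M * T) * (1 - q / X / (M * T)) * (1 - q / X * M / T) *
    (1 - q / X * T / M) / ((1 - (X ^ 2)⁻¹) * (1 - q ^ 2 / X ^ 2)))

/-- The coefficient `A` of the Askey–Wilson operator in multiplicative variables. -/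
def ratA (q X S R T M : k) : k :=
  (1 - q * X * R * S) * (1 - q * X * S / R) * (1 - q * X * M / T) * (1 - q * X / (M * T)) /
    ((1 - X ^ 2) * (1 - q ^ 2 * X ^ 2))

/-- The common denominator of the coefficients of `cert`. -/
def certDen (q b X : k) : k := b * ((1 - X ^ 2) * (1 - q ^ 2 * X ^ 2) * (X ^ 2 - q ^ 2))

/-- The coefficient of `y` in `cert`. -/
def certHigh (q b X L r s t a : k) : k :=
  q ^ 2 * X ^ 3 *
    ((X ^ 2 - q ^ 2) * (q * X * s - r) + L ^ 2 * (1 - q ^ 2 * X ^ 2) * (X * t - q * a)) /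
    (L * certDen q b X)

/-- The coefficient of `y⁻¹` in `cert`. -/
def certLow (q b X L r s t a : k) : k :=
  q * (L ^ 2 * (X ^ 2 - q ^ 2) * (s - q * X * r) + (1 - q ^ 2 * X ^ 2) * (q * t - a * X)) /
    (L * certDen q b X)

/-- The constant coefficient of `cert`. -/
def certMid (q b X L r s t a : k) : k :=
  X * ((X ^ 2 - q ^ 2) * (1 - q ^ 2 * L ^ 4 - q ^ 2 * X ^ 2 + q ^ 4 * X ^ 2 * L ^ 4
      + q ^ 2 * X * r * t * L ^ 2)
    - q * L ^ 2 * s * (t * X ^ 2 * (1 - q ^ 4) - q * a * X * (1 - q ^ 2 * X ^ 2))) /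
    (L ^ 2 * certDen q b X)

/-- The Laurent polynomial in `y` that certifies the Askey–Wilson equation. -/
def cert (q b X L r s t a y : k) : k :=
  certHigh q b X L r s t a * y + certMid q b X L r s t a + certLow q b X L r s t a / y

/-- The constant term of the quotient in `ratB_mul_sub_cert`. -/
def certP (q b X L S R r s t a : k) : k :=
  (ratB q b X S R * X / L - certMid q b X L r s t a * L + r * certHigh q b X L r s t a -
    s * certHigh q b X L r s t a / (X * q)) / (L * X * q)

/-- The constant term of the quotient in `ratD_mul_add_cert`. -/
def certQ (q b X L T M r s t a : k) : k :=
  L / X * (ratD q b X T M * q * X * L + certMid q b X L r s t a * q / L -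
    a * certHigh q b X L r s t a + t * certHigh q b X L r s t a * q / X)

/-- The four factors of the numerator are permuted by R ↦ 1/R and by S ↦ 1/S, so only R + 1/R and S
+ 1/S survive. This makes B compatible with `cert`, which sees the parameters only through such
sums. -/
theorem ratB_eq {q b X S R : k} (hS : S ≠ 0) (hR : R ≠ 0) : 
    ratB q b X S R = b⁻¹ * (((1 + q ^ 2 * X ^ 2) ^ 2 -
        q * X * (1 + q ^ 2 * X ^ 2) * (R + R⁻¹) * (S + S⁻¹) +
        q ^ 2 * X ^ 2 * ((R + R⁻¹) ^ 2 + (S + S⁻¹) ^ 2 - 4)) /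
      ((1 - X ^ 2) * (1 - q ^ 2 * X ^ 2))) := by
  unfold ratB
  congr 2
  field_simp
  ring

theorem ratD_eq {q b X T M : k} (hT : T ≠ 0) (hM : M ≠ 0) (hX : X ≠ 0) : 
    ratD q b X T M = b⁻¹ * (((X ^ 2 + q ^ 2) ^ 2 -
        q * X * (X ^ 2 + q ^ 2) * (T + T⁻¹) * (M + M⁻¹) +
        q ^ 2 * X ^ 2 * ((T + T⁻¹) ^ 2 + (M + M⁻¹) ^ 2 - 4)) /
      ((X ^ 2 - 1) * (X ^ 2 - q ^ 2))) := by
  have e : (X ^ 2 - 1) * (X ^ 2 - q ^ 2) = X ^ 4 * ((1 - (X ^ 2)⁻¹) * (1 - q ^ 2 / X ^ 2)) := by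
    field_simp
  rw [e, ← div_div]
  unfold ratD
  congr 2
  field_simp
  ring

/-- Division with zero remainder: the coefficients of `cert` make the left side vanish at both roots
yLXq = S and yLXq = 1/S of the divisor. The extreme terms of the quotient come from the y² and y⁻²
coefficients, and `certP` is read off from the coefficient of y. -/
theorem ratB_mul_sub_cert {q b X L S R t a y : k} (hq : q ≠ 0) (hb : b ≠ 0) (hX : X ≠ 0)
    (hL : L ≠ 0) (hS : S ≠ 0) (hR : R ≠ 0) (hy : y ≠ 0)
    (h1 : 1 - X ^ 2 ≠ 0) (h2 : 1 - q ^ 2 * X ^ 2 ≠ 0) (h3 : X ^ 2 - q ^ 2 ≠ 0) :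
    ratB q b X S R * (y * X / L + L / (y * X) - t) -
      cert q b X L (R + R⁻¹) (S + S⁻¹) t a y * (y * L + 1 / (y * L) - (R + R⁻¹)) =
    (y * L * X * q + 1 / (y * L * X * q) - (S + S⁻¹)) *
      (-(certHigh q b X L (R + R⁻¹) (S + S⁻¹) t a * y / (X * q)) +
        certP q b X L S R (R + R⁻¹) (S + S⁻¹) t a -
        certLow q b X L (R + R⁻¹) (S + S⁻¹) t a * X * q / y) := by
  unfold cert certP
  rw [ratB_eq hS hR]
  -- R and S now occur only through these sums, so r and s can be taken as independent variables of
  -- a rational identity.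
  generalize R + R⁻¹ = r
  generalize S + S⁻¹ = s
  unfold certHigh certMid certLow certDen
  field_simp
  ring

/-- The companion division for D, with the same `cert`. At y = q^(z-1) here and y = q^(z+1) in
`ratB_mul_sub_cert`, the non-constant parts of the two quotients are opposite. -/
theorem ratD_mul_add_cert {q b X L T M r s y : k} (hq : q ≠ 0) (hb : b ≠ 0) (hX : X ≠ 0)
    (hL : L ≠ 0) (hT : T ≠ 0) (hM : M ≠ 0) (hy : y ≠ 0)
    (h1 : 1 - X ^ 2 ≠ 0) (h2 : 1 - q ^ 2 * X ^ 2 ≠ 0) (h3 : X ^ 2 - q ^ 2 ≠ 0) :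
    ratD q b X T M * (y * q * X * L + 1 / (y * q * X * L) - s) +
      cert q b X L r s (T + T⁻¹) (M + M⁻¹) y * (y * q / L + L / (y * q) - (M + M⁻¹)) =
    (y * X / L + L / (y * X) - (T + T⁻¹)) *
      (certHigh q b X L r s (T + T⁻¹) (M + M⁻¹) * y * q / X +
        certQ q b X L T M r s (T + T⁻¹) (M + M⁻¹) +
        certLow q b X L r s (T + T⁻¹) (M + M⁻¹) * X / q / y) := by
  have h1' : X ^ 2 - 1 ≠ 0 := by rwa [← neg_sub, neg_ne_zero]
  have h2' : 1 - X ^ 2 * q ^ 2 ≠ 0 := by rwa [mul_comm]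
  unfold cert certQ
  rw [ratD_eq hT hM hX]
  generalize T + T⁻¹ = t
  generalize M + M⁻¹ = a
  rw [← neg_sub 1 (X ^ 2)]
  unfold certHigh certMid certLow certDen
  field_simp
  ring

/-- This is where T = bS is needed: A is symmetric under inversion of R and of M but not of S, so
the link between σ and β + σ must be explicit for A(x) + A(-x) to match the two quotients. -/
theorem certP_add_certQ {q b X L S R M : k} (hq : q ≠ 0) (hb : b ≠ 0) (hX : X ≠ 0)
    (hL : L ≠ 0) (hS : S ≠ 0) (hR : R ≠ 0) (hM : M ≠ 0)
    (h1 : 1 - X ^ 2 ≠ 0) (h2 : 1 - q ^ 2 * X ^ 2 ≠ 0) (h3 : X ^ 2 - q ^ 2 ≠ 0) :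
    certP q b X L S R (R + R⁻¹) (S + S⁻¹) (b * S + (b * S)⁻¹) (M + M⁻¹) +
      certQ q b X L (b * S) M (R + R⁻¹) (S + S⁻¹) (b * S + (b * S)⁻¹) (M + M⁻¹) -
      ratA q X S R (b * S) M - ratA q X⁻¹ S R (b * S) M =
    -1 - q ^ 2 / b ^ 2 + q / b * (L ^ 2 + (L ^ 2)⁻¹) := by
  have ea : ratA q X S R (b * S) M =
      (1 - q * X * S * (R + R⁻¹) + q ^ 2 * X ^ 2 * S ^ 2) *
        (1 - q * X / (b * S) * (M + M⁻¹) + q ^ 2 * X ^ 2 / (b * S) ^ 2) /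
      ((1 - X ^ 2) * (1 - q ^ 2 * X ^ 2)) := by
    unfold ratA
    congr 1
    field_simp
    ring
  have eb : ratA q X⁻¹ S R (b * S) M =
      -(X ^ 2 - q * X * S * (R + R⁻¹) + q ^ 2 * S ^ 2) *
        (X ^ 2 - q * X / (b * S) * (M + M⁻¹) + q ^ 2 / (b * S) ^ 2) /
      ((1 - X ^ 2) * (X ^ 2 - q ^ 2)) := by
    have e : (1 - X ^ 2) * (X ^ 2 - q ^ 2) =
        -X ^ 4 * ((1 - X⁻¹ ^ 2) * (1 - q ^ 2 * X⁻¹ ^ 2)) := by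
      field_simp
      ring
    rw [e, ← div_div]
    unfold ratA
    congr 1
    field_simp
    ring
  rw [ea, eb]
  unfold certP certQ
  rw [ratB_eq hS hR, ratD_eq (mul_ne_zero hb hS) hM hX, ← neg_sub 1 (X ^ 2)]
  generalize R + R⁻¹ = r
  generalize M + M⁻¹ = a
  unfold certHigh certMid certDen
  field_simp
  ring

end Certificate

/-! ### The exponential q^u, the infinite product, and 1/Γ: functional equation, quasi-periodicity,
zeros, conjugation. -/

theorem qPow_neg (τ u : ℂ) : qPow τ (-u) = (qPow τ u)⁻¹ := by
  apply eq_inv_of_mul_eq_one_left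
  rw [← qPow_add, neg_add_cancel, qPow_zero]

theorem qPow_two_mul_left (τ u : ℂ) : qPow (2 * τ) u = qPow τ (2 * u) := by
  unfold qPow; congr 1; ring

theorem qPow_int_div {τ : ℂ} (hτ : τ ≠ 0) (n : ℤ) : qPow τ (n / τ) = 1 := by
  rw [qPow, ← Complex.exp_int_mul_two_pi_mul_I n]; congr 1; field_simp

theorem qPow_add_one_div {τ : ℂ} (hτ : τ ≠ 0) (u : ℂ) : qPow τ (u + 1 / τ) = qPow τ u := by
  have h := qPow_int_div hτ 1
  rw [Int.cast_one] at h
  rw [qPow_add, h, mul_one]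

theorem qPow_half_period {τ : ℂ} (hτ : τ ≠ 0) : qPow τ (1 / (2 * τ)) = -1 := by
  rw [qPow, ← Complex.exp_pi_mul_I]; congr 1; field_simp

theorem eq_im_mul_I {τ : ℂ} (hτ : τ.re = 0) : τ = τ.im * Complex.I := by
  apply Complex.ext <;> simp [hτ]

theorem re_div {τ : ℂ} (hτ : τ.re = 0) (z : ℂ) : (z / τ).re = z.im / τ.im := by
  by_cases h : τ.im = 0
  · simp [Complex.div_re, Complex.normSq_apply, hτ, h]
  · simp [Complex.div_re, Complex.normSq_apply, hτ]
    field_simp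

theorem norm_qPow {τ : ℂ} (hτ : τ.re = 0) (u : ℂ) :
    ‖qPow τ u‖ = Real.exp (-(2 * Real.pi * τ.im * u.re)) := by
  rw [qPow, Complex.norm_exp]
  simp [hτ]

theorem conj_eq_neg {τ : ℂ} (hτ : τ.re = 0) : starRingEnd ℂ τ = -τ := by
  apply Complex.ext <;> simp [hτ]

theorem conj_qPow {τ : ℂ} (hτ : τ.re = 0) (u : ℂ) :
    starRingEnd ℂ (qPow τ u) = qPow τ (starRingEnd ℂ u) := by
  rw [qPow, qPow, ← Complex.exp_conj]
  simp [conj_eq_neg hτ, map_ofNat]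

theorem multipliable_qPochhammer {q : ℂ} (hq : ‖q‖ < 1) (b : ℂ) :
    Multipliable fun n : ℕ => 1 - b * q ^ n := by
  simp only [sub_eq_add_neg]
  apply multipliable_one_add_of_summable
  simpa using (summable_geometric_of_lt_one (norm_nonneg q) hq).mul_left ‖b‖

theorem qPochhammer_eq_mul {q : ℂ} (hq : ‖q‖ < 1) (b : ℂ) :
    qPochhammer b q = (1 - b) * qPochhammer (b * q) q := by
  have h := multipliable_qPochhammer hq (b * q)
  have e : ∀ n : ℕ, 1 - b * q * q ^ n = 1 - b * q ^ (n + 1) := fun n => by ring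
  simp only [qPochhammer, e] at h ⊢
  have := tprod_eq_zero_mul' (f := fun n : ℕ => 1 - b * q ^ n) h
  simpa using this

theorem qPochhammer_ne_zero {b q : ℂ} (hq : ‖q‖ < 1) (hb : ‖b‖ < 1) : qPochhammer b q ≠ 0 := by
  simp only [qPochhammer, sub_eq_add_neg]
  apply tprod_one_add_ne_zero_of_summable
  · intro n h
    have h1 : b * q ^ n = 1 := by linear_combination -h
    have h2 : ‖b * q ^ n‖ < 1 := by
      rw [norm_mul, norm_pow]
      exact mul_lt_one_of_nonneg_of_lt_one_left (norm_nonneg _) hb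
        (pow_le_one₀ (norm_nonneg _) hq.le)
    rw [h1] at h2
    simp at h2
  · simpa using (summable_geometric_of_lt_one (norm_nonneg q) hq).mul_left ‖b‖

theorem conj_qPochhammer {q : ℂ} (hq : ‖q‖ < 1) (b : ℂ) :
    starRingEnd ℂ (qPochhammer b q) = qPochhammer (starRingEnd ℂ b) (starRingEnd ℂ q) := by
  have := (multipliable_qPochhammer hq b).map_tprod (starRingEnd ℂ) Complex.continuous_conj
  simpa [qPochhammer] using this

/-- The entire function `1 / Γ_τ`. -/
def recGamma (τ x : ℂ) : ℂ :=
  qPochhammer (-qPow τ ((x + 1) / 2)) (qPow τ 1) / qPow τ (-(x ^ 2) / 16)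

theorem qGamma_eq_inv (τ x : ℂ) : qGamma τ x = (recGamma τ x)⁻¹ := by
  rw [recGamma, inv_div, qGamma]

@[fun_prop]
theorem differentiable_recGamma {τ : ℂ} (hτ : 0 < τ.im) : Differentiable ℂ (recGamma τ) := by
  unfold recGamma
  refine Differentiable.fun_div ?_ (by fun_prop) fun x => qPow_ne_zero _ _
  exact (differentiable_qPochhammer (norm_qPow_one_lt hτ)).comp
      (g := fun b => qPochhammer b (qPow τ 1)) (by fun_prop)

/-- `q^u + q^{-u}` -/
def qCosh (τ u : ℂ) : ℂ := qPow τ u + qPow τ (-u)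

theorem qPow_add_inv (τ u : ℂ) : qPow τ u + (qPow τ u)⁻¹ = qCosh τ u := by
  rw [qCosh, qPow_neg]

theorem qCosh_neg (τ u : ℂ) : qCosh τ (-u) = qCosh τ u := by
  rw [qCosh, qCosh, neg_neg, add_comm]

@[fun_prop]
theorem differentiable_qCosh (τ : ℂ) : Differentiable ℂ (qCosh τ) := by
  unfold qCosh; fun_prop

theorem qCosh_add_one_div {τ : ℂ} (hτ : τ ≠ 0) (u : ℂ) : qCosh τ (u + 1 / τ) = qCosh τ u := by
  rw [qCosh, qCosh, qPow_neg, qPow_neg, qPow_add_one_div hτ]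

/-- Product-to-sum formula; the half period κ flips the sign of one term, turning the sum into a
difference. -/
theorem qCosh_mul_qCosh {τ κ : ℂ} (hκ : qPow τ κ = -1) (a b : ℂ) :
    qCosh τ ((a - κ) / 2) * qCosh τ ((b - κ) / 2) =
      qCosh τ ((a - b) / 2) - qCosh τ ((a + b) / 2) := by
  have e1 : (a - b) / 2 = (a - κ) / 2 + -((b - κ) / 2) := by ring
  have e2 : (a + b) / 2 = (a - κ) / 2 + (b - κ) / 2 + κ := by ring
  simp only [qCosh, qPow_neg, e1, e2, qPow_add, hκ]
  have := qPow_ne_zero τ ((a - κ) / 2)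
  have := qPow_ne_zero τ ((b - κ) / 2)
  field_simp
  ring

section

variable {τ : ℂ}

theorem two_mul_im_pos (hτ : 0 < τ.im) : 0 < (2 * τ).im := by simpa using hτ

/-- Splitting off the first factor of the product gives 1 + q^u; the Gaussian contributes q^(-u/2)
and makes it symmetric. -/
theorem recGamma_sub_one (hτ : 0 < τ.im) (u : ℂ) :
    recGamma (2 * τ) (u - 1) = qCosh τ (u / 2) * recGamma (2 * τ) (u + 1) := by
  have h := qPochhammer_eq_mul (norm_qPow_one_lt (two_mul_im_pos hτ)) (-qPow (2 * τ) (u / 2))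
  have e1 : -qPow (2 * τ) (u / 2) * qPow (2 * τ) 1 = -qPow (2 * τ) ((u + 1 + 1) / 2) := by
    rw [neg_mul, ← qPow_add]; congr 2; ring
  rw [e1] at h
  unfold recGamma
  rw [sub_add_cancel, h]
  have e2 : qPow (2 * τ) (-(u - 1) ^ 2 / 16) =
      qPow τ (u / 2) * qPow (2 * τ) (-(u + 1) ^ 2 / 16) := by
    rw [qPow_two_mul_left, qPow_two_mul_left, ← qPow_add]; congr 1; ring
  have e3 : qPow (2 * τ) (u / 2) = qPow τ (u / 2) * qPow τ (u / 2) := by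
    rw [qPow_two_mul_left, ← qPow_add]; congr 1; ring
  rw [e2, e3, qCosh, qPow_neg]
  have := qPow_ne_zero τ (u / 2)
  have := qPow_ne_zero (2 * τ) (-(u + 1) ^ 2 / 16)
  field_simp
  ring

/-- The infinite product is 1/τ-periodic, so the multiplier comes from the Gaussian alone. -/
theorem recGamma_add_period (hτ : τ ≠ 0) (u : ℂ) :
    recGamma (2 * τ) (u + 1 / τ) =
      Complex.exp (2 * Real.pi * Complex.I * (u / 4 + 1 / (8 * τ))) * recGamma (2 * τ) u := by
  have e : qPow (2 * τ) ((u + 1 / τ + 1) / 2) = qPow (2 * τ) ((u + 1) / 2) := by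
    rw [qPow_two_mul_left, qPow_two_mul_left, ← qPow_add_one_div hτ (2 * ((u + 1) / 2))]
    congr 1; ring
  unfold recGamma
  rw [e, div_eq_mul_inv _ (qPow _ _), div_eq_mul_inv _ (qPow _ _), ← qPow_neg,
    ← qPow_neg, mul_left_comm]
  congr 1
  unfold qPow
  rw [← Complex.exp_add]
  congr 1
  field_simp
  ring

theorem recGamma_sub_period (hτ : τ ≠ 0) (u : ℂ) :
    recGamma (2 * τ) (u - 1 / τ) =
      Complex.exp (-(2 * Real.pi * Complex.I * (u / 4 - 1 / (8 * τ)))) * recGamma (2 * τ) u := by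
  have h := recGamma_add_period hτ (u - 1 / τ)
  rw [sub_add_cancel] at h
  rw [h, ← mul_assoc, ← Complex.exp_add, eq_comm]
  convert one_mul _
  rw [← Complex.exp_zero]
  congr 1
  field_simp
  ring

/-- For 0 < q < 1 the product starts at -q^(u+1), of modulus below 1 when Re u > -1, so no factor
vanishes. -/
theorem recGamma_ne_zero (hτ : 0 < τ.im) (hτ' : τ.re = 0) {u : ℂ} (hu : -1 < u.re) :
    recGamma (2 * τ) u ≠ 0 := by
  refine div_ne_zero (qPochhammer_ne_zero (norm_qPow_one_lt (two_mul_im_pos hτ)) ?_)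
    (qPow_ne_zero _ _)
  rw [norm_neg, qPow_two_mul_left, norm_qPow hτ', Real.exp_lt_one_iff, neg_lt_zero]
  have : 0 < (2 * ((u + 1) / 2)).re := by
    rw [mul_div_cancel₀ _ two_ne_zero]; simp; linarith
  have := Real.pi_pos
  positivity

theorem conj_recGamma (hτ : 0 < τ.im) (hτ' : τ.re = 0) (u : ℂ) :
    starRingEnd ℂ (recGamma (2 * τ) u) = recGamma (2 * τ) (starRingEnd ℂ u) := by
  have h2 : (2 * τ).re = 0 := by simp [hτ']
  rw [recGamma, map_div₀, conj_qPochhammer (norm_qPow_one_lt (two_mul_im_pos hτ)), map_neg]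
  simp only [conj_qPow h2]
  simp [recGamma, map_ofNat]

/-! ### The gamma quotient and its difference equation -/

/-- With `κ = 1 / (2τ)` and `μ = iλ` this is `f_λ(z; A - s, s)`. -/
def gammaQuot (τ κ A s μ z : ℂ) : ℂ :=
  recGamma (2 * τ) (1 - κ + A + μ - z) * recGamma (2 * τ) (-κ + s + μ + z) /
    (recGamma (2 * τ) (-1 - κ + A - μ + z) * recGamma (2 * τ) (-κ + s - μ - z))

/-- The common part of `gammaQuot` at `w + 1` and at `w - 1`. -/
def gammaCore (τ κ A s μ w : ℂ) : ℂ :=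
  recGamma (2 * τ) (2 - κ + A + μ - w) * recGamma (2 * τ) (1 - κ + s + μ + w) /
    (recGamma (2 * τ) (-2 - κ + A - μ + w) * recGamma (2 * τ) (-1 - κ + s - μ - w))

variable {κ A s μ w : ℂ}

/-- Only the two Γ-factors involving A have to be moved, each by one step of the functional
equation; the product of the two resulting factors is the stated difference. Nonvanishing at the
lower point lets the factor introduced in the denominator cancel. -/
theorem gammaQuot_add_one (hτ : 0 < τ.im) (hκ : qPow τ κ = -1)
    (h : recGamma (2 * τ) (-2 - κ + A - μ + w) ≠ 0) :
    gammaQuot τ κ A s μ (w + 1) =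
      (qCosh τ (w - 1 - μ) - qCosh τ A) * gammaCore τ κ A s μ w := by
  have e1 := recGamma_sub_one hτ (A - 1 - μ + w - κ)
  have e2 := recGamma_sub_one hτ (A + 1 + μ - w - κ)
  have e3 := qCosh_mul_qCosh hκ (A - 1 - μ + w) (A + 1 + μ - w)
  rw [show (A - 1 - μ + w - (A + 1 + μ - w)) / 2 = w - 1 - μ by ring,
    show (A - 1 - μ + w + (A + 1 + μ - w)) / 2 = A by ring] at e3
  rw [← e3]
  unfold gammaQuot gammaCore
  rw [show A - 1 - μ + w - κ - 1 = -2 - κ + A - μ + w by ring,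
    show A - 1 - μ + w - κ + 1 = -1 - κ + A - μ + (w + 1) by ring] at e1
  rw [show A + 1 + μ - w - κ - 1 = 1 - κ + A + μ - (w + 1) by ring,
    show A + 1 + μ - w - κ + 1 = 2 - κ + A + μ - w by ring] at e2
  rw [e1] at h
  rw [e1, e2, show -κ + s + μ + (w + 1) = 1 - κ + s + μ + w by ring,
    show -κ + s - μ - (w + 1) = -1 - κ + s - μ - w by ring]
  have h1 := left_ne_zero_of_mul h
  have h2 := right_ne_zero_of_mul h
  rw [mul_div_assoc', mul_assoc (qCosh τ ((A - 1 - μ + w - κ) / 2)),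
    mul_assoc (qCosh τ ((A - 1 - μ + w - κ) / 2)), mul_div_mul_left _ _ h1]
  ring

theorem gammaQuot_sub_one (hτ : 0 < τ.im) (hκ : qPow τ κ = -1)
    (h : recGamma (2 * τ) (-1 - κ + s - μ - w) ≠ 0) :
    gammaQuot τ κ A s μ (w - 1) =
      (qCosh τ (w + μ) - qCosh τ s) * gammaCore τ κ A s μ w := by
  have e1 := recGamma_sub_one hτ (s - μ - w - κ)
  have e2 := recGamma_sub_one hτ (s + μ + w - κ)
  have e3 := qCosh_mul_qCosh hκ (s - μ - w) (s + μ + w)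
  rw [show (s - μ - w - (s + μ + w)) / 2 = -(w + μ) by ring,
    show (s - μ - w + (s + μ + w)) / 2 = s by ring, qCosh_neg] at e3
  rw [← e3]
  unfold gammaQuot gammaCore
  rw [show s - μ - w - κ - 1 = -1 - κ + s - μ - w by ring,
    show s - μ - w - κ + 1 = -κ + s - μ - (w - 1) by ring] at e1
  rw [show s + μ + w - κ - 1 = -κ + s + μ + (w - 1) by ring,
    show s + μ + w - κ + 1 = 1 - κ + s + μ + w by ring] at e2
  rw [e1] at h
  rw [e1, e2, show 1 - κ + A + μ - (w - 1) = 2 - κ + A + μ - w by ring,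
    show -1 - κ + A - μ + (w - 1) = -2 - κ + A - μ + w by ring]
  have h1 := left_ne_zero_of_mul h
  rw [mul_div_assoc', mul_left_comm (recGamma (2 * τ) (-2 - κ + A - μ + w)),
    mul_assoc (qCosh τ ((s - μ - w - κ) / 2)), mul_div_mul_left _ _ h1]
  ring

/-- In the quotient of the four multipliers all dependence on w, κ and μ cancels. The constant left
over is 1 when A - s is an even integer, which is the role of the parity of α and β. -/
theorem gammaCore_add_period (hτ : τ ≠ 0) :
    gammaCore τ κ A s μ (w + 1 / τ) =
      Complex.exp (Real.pi * Complex.I * (s - A)) * gammaCore τ κ A s μ w := by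
  unfold gammaCore
  rw [← add_assoc, ← add_assoc, ← sub_sub, ← sub_sub]
  simp only [recGamma_add_period hτ, recGamma_sub_period hτ]
  rw [mul_mul_mul_comm, ← Complex.exp_add, mul_mul_mul_comm, ← Complex.exp_add, mul_div_mul_comm,
    ← Complex.exp_sub]
  congr 2
  field_simp
  ring

theorem gammaCore_add_period_of_even (hτ : τ ≠ 0) {n : ℤ} (hn : Even n) (hA : A = n + s) :
    gammaCore τ κ A s μ (w + 1 / τ) = gammaCore τ κ A s μ w := by
  obtain ⟨m, rfl⟩ := hn
  rw [gammaCore_add_period hτ]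
  convert one_mul _
  rw [← Complex.exp_int_mul_two_pi_mul_I (-m), hA]
  congr 1
  push_cast
  ring

theorem gammaQuot_differentiableAt (hτ : 0 < τ.im) {z : ℂ}
    (h1 : recGamma (2 * τ) (-1 - κ + A - μ + z) ≠ 0)
    (h2 : recGamma (2 * τ) (-κ + s - μ - z) ≠ 0) :
    DifferentiableAt ℂ (gammaQuot τ κ A s μ) z := by
  have hd := differentiable_recGamma (two_mul_im_pos hτ)
  unfold gammaQuot
  exact DifferentiableAt.fun_div (by fun_prop) (by fun_prop) (mul_ne_zero h1 h2)

theorem gammaCore_differentiableAt (hτ : 0 < τ.im)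
    (h1 : recGamma (2 * τ) (-2 - κ + A - μ + w) ≠ 0)
    (h2 : recGamma (2 * τ) (-1 - κ + s - μ - w) ≠ 0) :
    DifferentiableAt ℂ (gammaCore τ κ A s μ) w := by
  have hd := differentiable_recGamma (two_mul_im_pos hτ)
  unfold gammaCore
  exact DifferentiableAt.fun_div (by fun_prop) (by fun_prop) (mul_ne_zero h1 h2)

end

/-! ### Contour shift and the integral representation. -/

theorem integral_shift_eq {τ : ℂ} (hτ : 0 < τ.im) (hτ' : τ.re = 0) {G : ℂ → ℂ}
    (hG : ∀ z : ℂ, |z.re| ≤ 1 → DifferentiableAt ℂ G z) (hper : ∀ z, G (z + 1 / τ) = G z) :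
    ∫ y in (0 : ℝ)..1, G (y / τ + 1) = ∫ y in (0 : ℝ)..1, G (y / τ - 1) := by
  have hne : τ ≠ 0 := by rintro rfl; simp at hτ
  have hI := eq_im_mul_I hτ'
  -- In the variable ζ = τz the strip |Re z| ≤ 1 becomes |Im ζ| ≤ Im τ and the period becomes 1: the
  -- vertical sides cancel and the horizontal ones are the two integrals.
  have key := Complex.integral_boundary_rect_eq_zero_of_differentiableOn (fun ζ => G (ζ / τ))
    (-τ) (1 + τ) (by
      intro ζ hζ
      have him : ζ.im ∈ Set.uIcc (-τ.im) τ.im := by simpa using hζ.2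
      rw [Set.uIcc_of_le (by linarith)] at him
      refine (DifferentiableAt.comp ζ (hG _ ?_) (by fun_prop)).differentiableWithinAt
      rw [re_div hτ', abs_div, abs_of_pos hτ, div_le_one hτ, abs_le]
      exact him)
  have e1 : ∀ y : ℝ, (1 + (y : ℂ) * Complex.I) / τ = (y : ℂ) * Complex.I / τ + 1 / τ := by
    intro y; ring
  have e2 : ∀ y : ℝ, ((y : ℂ) + τ) / τ = y / τ + 1 := by
    intro y; field_simp
  have e3 : ∀ y : ℝ, ((y : ℂ) + -τ) / τ = y / τ - 1 := by
    intro y; field_simp; ring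
  simp only [Complex.neg_re, hτ', neg_zero, Complex.add_re, Complex.one_re, add_zero,
    Complex.neg_im, Complex.add_im, Complex.one_im, zero_add, Complex.ofReal_neg, neg_mul,
    Complex.ofReal_one, Complex.ofReal_zero, ← hI, e1, e2, e3, hper] at key
  simp only [add_sub_cancel_right] at key
  exact (sub_eq_zero.mp key).symm

theorem conj_gammaQuot {τ : ℂ} (hτ : 0 < τ.im) (hτ' : τ.re = 0) (κ A s μ z : ℂ) :
    starRingEnd ℂ (gammaQuot τ κ A s μ z) =
      gammaQuot τ (starRingEnd ℂ κ) (starRingEnd ℂ A) (starRingEnd ℂ s) (starRingEnd ℂ μ)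
        (starRingEnd ℂ z) := by
  simp [gammaQuot, conj_recGamma hτ hτ']

theorem fLam_apply (τ : UpperHalfPlane) (lam α ρ z : ℂ) :
    (fLam τ lam α ρ).1 z =
      gammaQuot τ (1 / (2 * τ)) (α + ρ) ρ (Complex.I * lam) z := by
  simp only [fLam, gammaQuot, qGamma_eq_inv]
  rw [← mul_inv, ← mul_inv, inv_div_inv]
  ring_nf

theorem phiIntegrand_eq (τ lam α ρ β σ x : ℂ) (y : ℝ) :
    phiIntegrand τ lam α ρ β σ x y =
      gammaQuot τ (1 / (2 * τ)) (β + σ) σ (Complex.I * lam) (x + 1 + y / τ) *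
        gammaQuot τ (-(1 / (2 * τ))) (α + ρ) ρ (-(Complex.I * lam)) (-(y / τ)) := by
  simp only [phiIntegrand, gammaQuot, qGamma_eq_inv]
  rw [← mul_inv, ← mul_inv, ← mul_inv, ← mul_inv, inv_div_inv, inv_div_inv]
  ring_nf

theorem piRep_hat_mul_K (τ lam x : ℂ) (f : Mero) (z : ℂ) :
    (piRep τ lam (gen τ (Gen.hat x) * gen τ Gen.K) f).1 z = f.1 (z + x + 1) := by
  simp [piRep, gen, genAction, shiftOp]

theorem re_ofReal_div {τ : ℂ} (hτ' : τ.re = 0) (y : ℝ) : ((y : ℂ) / τ).re = 0 := by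
  simp [re_div hτ']

theorem conj_ofReal_div {τ : ℂ} (hτ' : τ.re = 0) (y : ℝ) :
    starRingEnd ℂ ((y : ℂ) / τ) = -(y / τ) := by
  rw [map_div₀, conj_eq_neg hτ', Complex.conj_ofReal, div_neg]

/-- The integrands agree pointwise, so no convergence is needed: for imaginary τ, q is real, and
conjugation negates y/τ, κ and iλ while fixing α and ρ. -/
theorem phi_eq_integral (τ : UpperHalfPlane) (hτ : τ.re = 0) (lam ρ : ℝ) (α : ℤ) (β σ x : ℂ) :
    phi τ lam α ρ β σ x = ∫ y in (0 : ℝ)..1, phiIntegrand τ lam α ρ β σ x y := by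
  have h2 : starRingEnd ℂ (1 / (2 * (τ : ℂ))) = -(1 / (2 * τ)) := by
    have := conj_ofReal_div (τ := τ) hτ (1 / 2)
    convert this using 2 <;> push_cast <;> field_simp
  unfold phi pairing
  congr 1
  ext y
  rw [phiIntegrand_eq, piRep_hat_mul_K, fLam_apply, fLam_apply, conj_gammaQuot τ.im_pos hτ,
    conj_ofReal_div hτ, h2]
  simp only [map_add, map_mul, map_intCast, Complex.conj_ofReal, Complex.conj_I, neg_mul]
  ring_nf

theorem intervalIntegrable_phiIntegrand {τ : ℂ} (hτ : 0 < τ.im) (hτ' : τ.re = 0) (lam : ℝ)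
    {α ρ β σ x : ℂ} (h1 : -1 < (β + σ + x).re) (h2 : 0 < (σ - x).re) (h3 : 0 < (α + ρ).re)
    (h4 : -1 < ρ.re) :
    IntervalIntegrable (phiIntegrand τ lam α ρ β σ x) MeasureTheory.volume 0 1 := by
  apply Continuous.intervalIntegrable
  have hk : (1 / (2 * τ)).re = 0 := by
    have := re_ofReal_div (τ := τ) hτ' (1 / 2)
    rw [← this]; congr 1; push_cast; field_simp
  have hy := re_ofReal_div hτ'
  simp only [Complex.add_re, Complex.sub_re] at h1 h2 h3
  rw [continuous_iff_continuousAt]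
  intro y
  simp only [funext (phiIntegrand_eq τ lam α ρ β σ x)]
  have e1 : ContinuousAt (fun y : ℝ => x + 1 + (y : ℂ) / τ) y := by fun_prop
  have e2 : ContinuousAt (fun y : ℝ => -((y : ℂ) / τ)) y := by fun_prop
  refine ContinuousAt.mul
    (ContinuousAt.comp' (gammaQuot_differentiableAt hτ ?_ ?_).continuousAt e1)
    (ContinuousAt.comp' (gammaQuot_differentiableAt hτ ?_ ?_).continuousAt e2)
  all_goals
    apply recGamma_ne_zero hτ hτ'
    simp only [Complex.add_re, Complex.sub_re, Complex.neg_re, Complex.one_re, hk, hy, Complex.mul_re,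
      Complex.I_re, Complex.I_im, Complex.ofReal_re, Complex.ofReal_im]
    linarith

/-! ### The Askey–Wilson equation -/

theorem qPow_sub (τ u v : ℂ) : qPow τ (u - v) = qPow τ u / qPow τ v := by
  rw [sub_eq_add_neg, qPow_add, qPow_neg, div_eq_mul_inv]

theorem qPow_two_mul (τ u : ℂ) : qPow τ (2 * u) = qPow τ u ^ 2 := by
  rw [two_mul, qPow_add, sq]

theorem qPow_two (τ : ℂ) : qPow τ 2 = qPow τ 1 ^ 2 := by
  rw [← qPow_two_mul, mul_one]

/-- The factor that makes `gammaCore · gammaCore` a certificate for the Askey–Wilson equation. -/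
def certFun (τ α ρ β σ μ x z : ℂ) : ℂ :=
  cert (qPow τ 1) (qPow τ β) (qPow τ x) (qPow τ μ) (qCosh τ ρ) (qCosh τ σ) (qCosh τ (β + σ))
    (qCosh τ (α + ρ)) (qPow τ z)

/-- The non-constant terms of the quotients in `coeffB_mul_sub` and `coeffD_mul_add`. -/
def certOsc (τ α ρ β σ μ x z : ℂ) : ℂ :=
  certHigh (qPow τ 1) (qPow τ β) (qPow τ x) (qPow τ μ) (qCosh τ ρ) (qCosh τ σ)
      (qCosh τ (β + σ)) (qCosh τ (α + ρ)) * qPow τ z / qPow τ x +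
    certLow (qPow τ 1) (qPow τ β) (qPow τ x) (qPow τ μ) (qCosh τ ρ) (qCosh τ σ)
      (qCosh τ (β + σ)) (qCosh τ (α + ρ)) * qPow τ x / qPow τ z

/-- The constant term of the quotient in `coeffB_mul_sub`. -/
def certConstB (τ α ρ β σ μ x : ℂ) : ℂ :=
  certP (qPow τ 1) (qPow τ β) (qPow τ x) (qPow τ μ) (qPow τ σ) (qPow τ ρ) (qCosh τ ρ) (qCosh τ σ)
    (qCosh τ (β + σ)) (qCosh τ (α + ρ))

/-- The constant term of the quotient in `coeffD_mul_add`. -/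
def certConstD (τ α ρ β σ μ x : ℂ) : ℂ :=
  certQ (qPow τ 1) (qPow τ β) (qPow τ x) (qPow τ μ) (qPow τ (β + σ)) (qPow τ (α + ρ)) (qCosh τ ρ)
    (qCosh τ σ) (qCosh τ (β + σ)) (qCosh τ (α + ρ))

/-- The function whose difference `z - 1 → z + 1` is the integrand of `(𝓛 - E(λ)) φ_λ(x)`. -/
def telescoper (τ κ α ρ β σ μ x z : ℂ) : ℂ :=
  certFun τ α ρ β σ μ x z * (qCosh τ (z + μ) - qCosh τ ρ) *
    (qCosh τ (z + 1 - μ) - qCosh τ (α + ρ)) *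
    (gammaCore τ κ (β + σ) σ μ (x + 1 + z) * gammaCore τ (-κ) (α + ρ) ρ (-μ) (-z))

theorem coeffB_eq (τ ρ β σ x : ℂ) :
    coeffB τ ρ β σ x = ratB (qPow τ 1) (qPow τ β) (qPow τ x) (qPow τ σ) (qPow τ ρ) := by
  have h1 := qPow_ne_zero τ 1
  have h2 := qPow_ne_zero τ σ
  have h3 := qPow_ne_zero τ ρ
  simp only [coeffB, ratB, parA, parB, qPow_add, qPow_sub, qPow_neg, qPow_two_mul, qPow_two]
  congr 2
  field_simp

theorem coeffD_eq (τ α ρ β σ x : ℂ) :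
    coeffD τ α ρ β σ x =
      ratD (qPow τ 1) (qPow τ β) (qPow τ x) (qPow τ (β + σ)) (qPow τ (α + ρ)) := by
  have h1 := qPow_ne_zero τ 1
  have h2 := qPow_ne_zero τ σ
  have h3 := qPow_ne_zero τ ρ
  have h4 := qPow_ne_zero τ α
  have h5 := qPow_ne_zero τ β
  have h6 := qPow_ne_zero τ x
  simp only [coeffD, ratD, parC, parD, qPow_add, qPow_sub, qPow_neg, qPow_two_mul, qPow_two]
  congr 2
  field_simp

theorem coeffA_eq (τ α ρ β σ x : ℂ) :
    coeffA τ (parA ρ σ) (parB ρ σ) (parC α ρ β σ) (parD α ρ β σ) x =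
      ratA (qPow τ 1) (qPow τ x) (qPow τ σ) (qPow τ ρ) (qPow τ (β + σ)) (qPow τ (α + ρ)) := by
  have h1 := qPow_ne_zero τ 1
  have h2 := qPow_ne_zero τ σ
  have h3 := qPow_ne_zero τ ρ
  have h4 := qPow_ne_zero τ α
  have h5 := qPow_ne_zero τ β
  have h6 := qPow_ne_zero τ x
  simp only [coeffA, ratA, parA, parB, parC, parD, qPow_add, qPow_sub, qPow_two_mul, qPow_two]
  congr 1
  field_simp

theorem eigenE_eq (τ lam β : ℂ) :
    eigenE τ lam β = -1 - qPow τ 1 ^ 2 / qPow τ β ^ 2 +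
      qPow τ 1 / qPow τ β *
        (qPow τ (Complex.I * lam) ^ 2 + (qPow τ (Complex.I * lam) ^ 2)⁻¹) := by
  simp only [eigenE, qPow_sub, qPow_neg, mul_assoc, qPow_two_mul, qPow_two]

section

variable {τ κ α ρ β σ μ x z : ℂ}

theorem coeffB_mul_sub (hx : 1 - qPow τ x ^ 2 ≠ 0) (hx' : 1 - qPow τ 1 ^ 2 * qPow τ x ^ 2 ≠ 0)
    (hx'' : qPow τ x ^ 2 - qPow τ 1 ^ 2 ≠ 0) :
    coeffB τ ρ β σ x * (qCosh τ (x + 1 + (z + 1) - 1 - μ) - qCosh τ (β + σ)) -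
      certFun τ α ρ β σ μ x (z + 1) * (qCosh τ (z + 1 + μ) - qCosh τ ρ) =
    (qCosh τ (x + 1 + (z + 1) + μ) - qCosh τ σ) *
      (certConstB τ α ρ β σ μ x - certOsc τ α ρ β σ μ x z) := by
  have h := ratB_mul_sub_cert (qPow_ne_zero τ 1) (qPow_ne_zero τ β) (qPow_ne_zero τ x)
    (qPow_ne_zero τ μ)
    (qPow_ne_zero τ σ) (qPow_ne_zero τ ρ) (qPow_ne_zero τ (z + 1)) hx hx' hx''
    (t := qCosh τ (β + σ)) (a := qCosh τ (α + ρ))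
  have := qPow_ne_zero τ 1
  have := qPow_ne_zero τ x
  have := qPow_ne_zero τ z
  simp only [qPow_add_inv] at h
  have a1 : qCosh τ (x + 1 + (z + 1) - 1 - μ) =
      qPow τ (z + 1) * qPow τ x / qPow τ μ + qPow τ μ / (qPow τ (z + 1) * qPow τ x) := by
    rw [show x + 1 + (z + 1) - 1 - μ = z + 1 + x - μ by ring, ← qPow_add_inv, qPow_sub,
      qPow_add _ (z + 1), inv_div]
  have a2 : qCosh τ (z + 1 + μ) =
      qPow τ (z + 1) * qPow τ μ + 1 / (qPow τ (z + 1) * qPow τ μ) := by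
    rw [← qPow_add_inv, qPow_add _ (z + 1), one_div]
  have a3 : qCosh τ (x + 1 + (z + 1) + μ) =
      qPow τ (z + 1) * qPow τ μ * qPow τ x * qPow τ 1 +
        1 / (qPow τ (z + 1) * qPow τ μ * qPow τ x * qPow τ 1) := by
    rw [show x + 1 + (z + 1) + μ = z + 1 + μ + x + 1 by ring, ← qPow_add_inv, qPow_add,
      qPow_add, qPow_add _ (z + 1), one_div]
  rw [coeffB_eq, certFun, a1, a2, a3, h]
  congr 1
  unfold certConstB certOsc
  simp only [qPow_add _ z 1]
  field_simp
  ring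

theorem coeffD_mul_add (hx : 1 - qPow τ x ^ 2 ≠ 0) (hx' : 1 - qPow τ 1 ^ 2 * qPow τ x ^ 2 ≠ 0)
    (hx'' : qPow τ x ^ 2 - qPow τ 1 ^ 2 ≠ 0) :
    coeffD τ α ρ β σ x * (qCosh τ (x + 1 + (z - 1) + μ) - qCosh τ σ) +
      certFun τ α ρ β σ μ x (z - 1) * (qCosh τ (z - 1 + 1 - μ) - qCosh τ (α + ρ)) =
    (qCosh τ (x + 1 + (z - 1) - 1 - μ) - qCosh τ (β + σ)) *
      (certConstD τ α ρ β σ μ x + certOsc τ α ρ β σ μ x z) := by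
  have h := ratD_mul_add_cert (qPow_ne_zero τ 1) (qPow_ne_zero τ β) (qPow_ne_zero τ x)
    (qPow_ne_zero τ μ)
    (qPow_ne_zero τ (β + σ)) (qPow_ne_zero τ (α + ρ)) (qPow_ne_zero τ (z - 1)) hx hx' hx''
    (r := qCosh τ ρ) (s := qCosh τ σ)
  have := qPow_ne_zero τ 1
  have := qPow_ne_zero τ x
  have := qPow_ne_zero τ z
  simp only [qPow_add_inv] at h
  have a1 : qCosh τ (x + 1 + (z - 1) - 1 - μ) =
      qPow τ (z - 1) * qPow τ x / qPow τ μ + qPow τ μ / (qPow τ (z - 1) * qPow τ x) := by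
    rw [show x + 1 + (z - 1) - 1 - μ = z - 1 + x - μ by ring, ← qPow_add_inv, qPow_sub,
      qPow_add _ (z - 1), inv_div]
  have a2 : qCosh τ (z - 1 + 1 - μ) =
      qPow τ (z - 1) * qPow τ 1 / qPow τ μ + qPow τ μ / (qPow τ (z - 1) * qPow τ 1) := by
    rw [← qPow_add_inv, qPow_sub, qPow_add _ (z - 1), inv_div]
  have a3 : qCosh τ (x + 1 + (z - 1) + μ) =
      qPow τ (z - 1) * qPow τ 1 * qPow τ x * qPow τ μ +
        1 / (qPow τ (z - 1) * qPow τ 1 * qPow τ x * qPow τ μ) := by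
    rw [show x + 1 + (z - 1) + μ = z - 1 + 1 + x + μ by ring, ← qPow_add_inv, qPow_add,
      qPow_add, qPow_add _ (z - 1), one_div]
  rw [coeffD_eq, certFun, a1, a2, a3, h]
  congr 1
  unfold certConstD certOsc
  simp only [qPow_sub _ z 1]
  field_simp
  ring

theorem certConst_add (hx : 1 - qPow τ x ^ 2 ≠ 0) (hx' : 1 - qPow τ 1 ^ 2 * qPow τ x ^ 2 ≠ 0)
    (hx'' : qPow τ x ^ 2 - qPow τ 1 ^ 2 ≠ 0) :
    certConstB τ α ρ β σ μ x + certConstD τ α ρ β σ μ x + coeffC τ α ρ β σ x =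
      -1 - qPow τ 1 ^ 2 / qPow τ β ^ 2 +
        qPow τ 1 / qPow τ β * (qPow τ μ ^ 2 + (qPow τ μ ^ 2)⁻¹) := by
  have h := certP_add_certQ (qPow_ne_zero τ 1) (qPow_ne_zero τ β) (qPow_ne_zero τ x)
    (qPow_ne_zero τ μ)
    (qPow_ne_zero τ σ) (qPow_ne_zero τ ρ) (qPow_ne_zero τ (α + ρ)) hx hx' hx''
  simp only [← qPow_add, qPow_add_inv] at h
  rw [← qPow_neg] at h
  rw [coeffC, coeffA_eq, coeffA_eq, ← h, certConstB, certConstD]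
  ring

theorem telescoper_add_period (hτ : τ ≠ 0) {m n : ℤ} (hm : Even m) (hn : Even n)
    (hα : α = m) (hβ : β = n) :
    telescoper τ κ α ρ β σ μ x (z + 1 / τ) = telescoper τ κ α ρ β σ μ x z := by
  have e := gammaCore_add_period_of_even (τ := τ) (κ := -κ) (A := α + ρ) (s := ρ) (μ := -μ)
    (w := -(z + 1 / τ)) hτ hm (by rw [hα])
  rw [show -(z + 1 / τ) + 1 / τ = -z by ring] at e
  simp only [telescoper, certFun]
  rw [← e, show x + 1 + (z + 1 / τ) = x + 1 + z + 1 / τ by ring,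
    gammaCore_add_period_of_even hτ hn (by rw [hβ]), qPow_add_one_div hτ,
    show z + 1 / τ + μ = z + μ + 1 / τ by ring, qCosh_add_one_div hτ,
    show z + 1 / τ + 1 - μ = z + 1 - μ + 1 / τ by ring, qCosh_add_one_div hτ]

theorem telescoper_differentiableAt (hτ : 0 < τ.im)
    (h1 : recGamma (2 * τ) (-2 - κ + (β + σ) - μ + (x + 1 + z)) ≠ 0)
    (h2 : recGamma (2 * τ) (-1 - κ + σ - μ - (x + 1 + z)) ≠ 0)
    (h3 : recGamma (2 * τ) (-2 - -κ + (α + ρ) - -μ + -z) ≠ 0)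
    (h4 : recGamma (2 * τ) (-1 - -κ + ρ - -μ - -z) ≠ 0) :
    DifferentiableAt ℂ (telescoper τ κ α ρ β σ μ x) z := by
  have d1 : DifferentiableAt ℂ (fun z => gammaCore τ κ (β + σ) σ μ (x + 1 + z)) z :=
    DifferentiableAt.comp z (g := gammaCore τ κ (β + σ) σ μ) (f := fun z => x + 1 + z)
      (gammaCore_differentiableAt hτ h1 h2) (by fun_prop)
  have d2 : DifferentiableAt ℂ (fun z => gammaCore τ (-κ) (α + ρ) ρ (-μ) (-z)) z :=
    DifferentiableAt.comp z (g := gammaCore τ (-κ) (α + ρ) ρ (-μ)) (f := fun z => -z)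
      (gammaCore_differentiableAt hτ h3 h4) (by fun_prop)
  have d3 : DifferentiableAt ℂ (certFun τ α ρ β σ μ x) z := by
    have := qPow_ne_zero τ z
    unfold certFun cert
    fun_prop (disch := assumption)
  unfold telescoper
  fun_prop

/-- In T(z + 1) and in T(z - 1), one trigonometric factor times the second core collapses to H(z).
After removing H, the identity involves only the first core at z ± 1 and reduces to the two
divisions. -/
theorem telescoper_sub (hτ : 0 < τ.im) (hκ : qPow τ κ = -1)
    (hx : 1 - qPow τ x ^ 2 ≠ 0) (hx' : 1 - qPow τ 1 ^ 2 * qPow τ x ^ 2 ≠ 0)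
    (hx'' : qPow τ x ^ 2 - qPow τ 1 ^ 2 ≠ 0)
    (h1 : ∀ s : ℂ, |s.re| ≤ 1 → recGamma (2 * τ) (-2 - κ + (β + σ) - μ + (x + 1 + (z + s))) ≠ 0)
    (h2 : ∀ s : ℂ, |s.re| ≤ 1 → recGamma (2 * τ) (-1 - κ + σ - μ - (x + 1 + (z + s))) ≠ 0)
    (h3 : ∀ s : ℂ, |s.re| ≤ 1 → recGamma (2 * τ) (-2 - -κ + (α + ρ) - -μ + -(z + s)) ≠ 0)
    (h4 : ∀ s : ℂ, |s.re| ≤ 1 → recGamma (2 * τ) (-1 - -κ + ρ - -μ - -(z + s)) ≠ 0) :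
    (coeffB τ ρ β σ x * gammaQuot τ κ (β + σ) σ μ (x + 2 + 1 + z) +
      (coeffC τ α ρ β σ x - (-1 - qPow τ 1 ^ 2 / qPow τ β ^ 2 +
        qPow τ 1 / qPow τ β * (qPow τ μ ^ 2 + (qPow τ μ ^ 2)⁻¹))) *
        gammaQuot τ κ (β + σ) σ μ (x + 1 + z) +
      coeffD τ α ρ β σ x * gammaQuot τ κ (β + σ) σ μ (x - 2 + 1 + z)) *
        gammaQuot τ (-κ) (α + ρ) ρ (-μ) (-z) =
      telescoper τ κ α ρ β σ μ x (z + 1) - telescoper τ κ α ρ β σ μ x (z - 1) := by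
  have hκ' : qPow τ (-κ) = -1 := by rw [qPow_neg, hκ]; norm_num
  have h1p := h1 1 (by simp)
  have h1m := h1 (-1) (by simp)
  have h2p := h2 1 (by simp)
  have h2m := h2 (-1) (by simp)
  have h3p := h3 1 (by simp)
  have h4m := h4 (-1) (by simp)
  rw [← sub_eq_add_neg z 1] at h1m h2m h4m
  -- F is written through the core at z + 1 (`f2`) and through the core at z - 1 (`f3`); `f1` and
  -- `f4` express F(z + 2) and F(z - 2) through the same two cores, and `f5`, `f6` give both forms
  -- of H.
  have f1 := gammaQuot_add_one hτ hκ h1p (s := σ)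
  have f2 := gammaQuot_sub_one hτ hκ h2p (A := β + σ)
  have f3 := gammaQuot_add_one hτ hκ h1m (s := σ)
  have f4 := gammaQuot_sub_one hτ hκ h2m (A := β + σ)
  have f5 := gammaQuot_add_one hτ hκ' h3p (s := ρ)
  have f6 := gammaQuot_sub_one hτ hκ' h4m (A := α + ρ)
  rw [show x + 1 + (z + 1) + 1 = x + 2 + 1 + z by ring] at f1
  rw [show x + 1 + (z + 1) - 1 = x + 1 + z by ring] at f2
  rw [show x + 1 + (z - 1) + 1 = x + 1 + z by ring] at f3
  rw [show x + 1 + (z - 1) - 1 = x - 2 + 1 + z by ring] at f4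
  rw [show -(z + 1) + 1 = -z by ring, show -(z + 1) - 1 - -μ = -(z + 1 + 1 - μ) by ring,
    qCosh_neg] at f5
  rw [show -(z - 1) - 1 = -z by ring, show -(z - 1) + -μ = -(z - 1 + μ) by ring, qCosh_neg] at f6
  have i1 := coeffB_mul_sub (α := α) (β := β) (ρ := ρ) (σ := σ) (μ := μ) (z := z) hx hx' hx''
  have i2 := coeffD_mul_add (α := α) (β := β) (ρ := ρ) (σ := σ) (μ := μ) (z := z) hx hx' hx''
  have i3 := certConst_add (α := α) (β := β) (ρ := ρ) (σ := σ) (μ := μ) hx hx' hx''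
  unfold telescoper
  generalize gammaQuot τ (-κ) (α + ρ) ρ (-μ) (-z) = H at *
  generalize gammaQuot τ κ (β + σ) σ μ (x + 1 + z) = F at *
  generalize gammaCore τ κ (β + σ) σ μ (x + 1 + (z + 1)) = γp at *
  generalize gammaCore τ κ (β + σ) σ μ (x + 1 + (z - 1)) = γm at *
  -- `i1` and `i2` produce multiples of the cores that `f2` and `f3` convert back to F; the
  -- oscillating terms then cancel, and `i3` identifies the remaining constant with E - C.
  linear_combination coeffB τ ρ β σ x * H * f1 + coeffD τ α ρ β σ x * H * f4 + γp * H * i1 +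
    γm * H * i2 + certFun τ α ρ β σ μ x (z + 1) * (qCosh τ (z + 1 + μ) - qCosh τ ρ) * γp * f5 -
    certFun τ α ρ β σ μ x (z - 1) * (qCosh τ (z - 1 + 1 - μ) - qCosh τ (α + ρ)) * γm * f6 -
    (certConstB τ α ρ β σ μ x - certOsc τ α ρ β σ μ x z) * H * f2 -
    (certConstD τ α ρ β σ μ x + certOsc τ α ρ β σ μ x z) * H * f3 + F * H * i3

end

/-! ### Integrating the telescoping identity. -/

theorem opL_phi (τ : UpperHalfPlane) (hτ : τ.re = 0) (lam : ℝ) {α β : ℤ}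
    (hα : 0 < α) (hα2 : Even α) (hβ : 0 < β) (hβ2 : Even β) {ρ σ : ℝ} (hρ : 3 ≤ ρ) (hσ : 3 ≤ σ)
    {x : ℂ} (hx : x.re = 0) (hx2 : qPow τ (2 * x) ≠ 1) :
    opL τ α ρ β σ (phi τ lam α ρ β σ) x = eigenE τ lam β * phi τ lam α ρ β σ x := by
  have him : 0 < (τ : ℂ).im := τ.im_pos
  have hre : (τ : ℂ).re = 0 := hτ
  have hne : (τ : ℂ) ≠ 0 := τ.ne_zero
  have hα' : (0 : ℝ) < α := by exact_mod_cast hα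
  have hβ' : (0 : ℝ) < β := by exact_mod_cast hβ
  have hκ : (1 / (2 * (τ : ℂ))).re = 0 := by simp [hτ]
  have hn : ‖qPow τ x‖ = 1 := by simp [norm_qPow hre, hx]
  have hq : ‖qPow τ 1‖ < 1 := norm_qPow_one_lt him
  have hint : ∀ s : ℝ, |s| ≤ 2 → IntervalIntegrable (phiIntegrand τ lam α ρ β σ (x + s))
      MeasureTheory.volume 0 1 := by
    intro s hs
    rw [abs_le] at hs
    apply intervalIntegrable_phiIntegrand him hre <;> simp [hx] <;> linarith
  have i0 := hint 0 (by simp)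
  have i1 := hint 2 (by simp)
  have i2 := hint (-2) (by simp)
  push_cast at i0 i1 i2
  rw [add_zero] at i0
  rw [← sub_eq_add_neg] at i2
  have key : ∀ y : ℝ, coeffB τ ρ β σ x * phiIntegrand τ lam α ρ β σ (x + 2) y +
      (coeffC τ α ρ β σ x - eigenE τ lam β) * phiIntegrand τ lam α ρ β σ x y +
      coeffD τ α ρ β σ x * phiIntegrand τ lam α ρ β σ (x - 2) y =
      telescoper τ (1 / (2 * τ)) α ρ β σ (Complex.I * lam) x (y / τ + 1) -
        telescoper τ (1 / (2 * τ)) α ρ β σ (Complex.I * lam) x (y / τ - 1) := by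
    intro y
    rw [← telescoper_sub him (qPow_half_period hne)]
    · simp only [phiIntegrand_eq, eigenE_eq]
      ring
    · rw [← qPow_two_mul]
      exact sub_ne_zero.mpr hx2.symm
    -- On the imaginary axis |q^x| = 1 while |q| < 1, so the other two denominators cannot vanish.
    · intro h
      have h2 : ‖qPow τ 1 ^ 2 * qPow τ x ^ 2‖ = 1 := by
        rw [← sub_eq_zero.mp h, norm_one]
      rw [norm_mul, norm_pow, norm_pow, hn, one_pow, mul_one] at h2
      exact (pow_lt_one₀ (norm_nonneg _) hq two_ne_zero).ne h2
    · intro h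
      have h2 : ‖qPow τ 1 ^ 2‖ = 1 := by
        rw [← sub_eq_zero.mp h, norm_pow, hn, one_pow]
      rw [norm_pow] at h2
      exact (pow_lt_one₀ (norm_nonneg _) hq two_ne_zero).ne h2
    all_goals
      -- The arguments have real parts at least β + σ - 2, σ - 3, α + ρ - 3 and ρ - 2, all above the
      -- threshold -1.
      intro s hs
      rw [abs_le] at hs
      apply recGamma_ne_zero him hre
      simp only [Complex.add_re, Complex.sub_re, Complex.neg_re, Complex.one_re, Complex.re_ofNat,
        hκ, re_ofReal_div hre, Complex.mul_re, Complex.I_re, Complex.I_im, Complex.ofReal_re,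
        Complex.ofReal_im, Complex.intCast_re, hx]
      linarith
  have hdiff : ∀ z : ℂ, |z.re| ≤ 1 → DifferentiableAt ℂ
      (telescoper τ (1 / (2 * τ)) α ρ β σ (Complex.I * lam) x) z := by
    intro z hz
    rw [abs_le] at hz
    apply telescoper_differentiableAt him
    all_goals
      apply recGamma_ne_zero him hre
      simp only [Complex.add_re, Complex.sub_re, Complex.neg_re, Complex.one_re,
        Complex.re_ofNat, hκ, Complex.mul_re, Complex.I_re, Complex.I_im, Complex.ofReal_re,
        Complex.ofReal_im, Complex.intCast_re, hx]
      linarith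
  have hcont : ∀ s : ℂ, |s.re| ≤ 1 → Continuous fun y : ℝ =>
      telescoper τ (1 / (2 * τ)) α ρ β σ (Complex.I * lam) x (y / τ + s) := by
    intro s hs
    rw [continuous_iff_continuousAt]
    intro y
    refine ContinuousAt.comp' (f := fun y : ℝ => (y : ℂ) / τ + s)
      (hdiff _ ?_).continuousAt (by fun_prop)
    rwa [Complex.add_re, re_ofReal_div hre, zero_add]
  have hshift := integral_shift_eq him hre hdiff
    (fun z => telescoper_add_period hne hα2 hβ2 rfl rfl)
  have hzero : ∫ y in (0 : ℝ)..1, (coeffB τ ρ β σ x * phiIntegrand τ lam α ρ β σ (x + 2) y +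
      (coeffC τ α ρ β σ x - eigenE τ lam β) * phiIntegrand τ lam α ρ β σ x y +
      coeffD τ α ρ β σ x * phiIntegrand τ lam α ρ β σ (x - 2) y) = 0 := by
    have c1 := hcont 1 (by simp)
    have c2 := hcont (-1) (by simp)
    simp only [← sub_eq_add_neg] at c2
    simp only [key]
    rw [intervalIntegral.integral_sub (c1.intervalIntegrable _ _) (c2.intervalIntegrable _ _),
      hshift, sub_self]
  rw [intervalIntegral.integral_add ((i1.const_mul _).add (i0.const_mul _)) (i2.const_mul _),
    intervalIntegral.integral_add (i1.const_mul _) (i0.const_mul _),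
    intervalIntegral.integral_const_mul, intervalIntegral.integral_const_mul,
    intervalIntegral.integral_const_mul] at hzero
  simp only [← phi_eq_integral τ hτ] at hzero
  rw [opL]
  linear_combination hzero

end AskeyWilson

end

theorem mainTheorem1 (τ : UpperHalfPlane) (hτ : τ.re = 0) (lam : ℝ) (α β : ℤ)
    (hα : 0 < α) (hα2 : Even α) (hβ : 0 < β) (hβ2 : Even β)
    (ρ σ : ℝ) (hρ : 3 ≤ ρ) (hσ : 3 ≤ σ) :
    (∀ x : ℂ, |x.re| ≤ 2 →
      IntervalIntegrable (AskeyWilson.phiIntegrand τ lam α ρ β σ x) MeasureTheory.volume 0 1 ∧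
      AskeyWilson.phi τ lam α ρ β σ x =
        ∫ y in (0 : ℝ)..1, AskeyWilson.phiIntegrand τ lam α ρ β σ x y) ∧
    (∀ x : ℂ, x.re = 0 → AskeyWilson.qPow τ (2 * x) ≠ 1 →
      AskeyWilson.opL τ α ρ β σ (AskeyWilson.phi τ lam α ρ β σ) x =
        AskeyWilson.eigenE τ lam β * AskeyWilson.phi τ lam α ρ β σ x) := by
  refine ⟨fun x hx => ⟨?_, AskeyWilson.phi_eq_integral τ hτ lam ρ α β σ x⟩,
    fun x hx hx2 => AskeyWilson.opL_phi τ hτ lam hα hα2 hβ hβ2 hρ hσ hx hx2⟩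
  have hα' : (0 : ℝ) < α := by exact_mod_cast hα
  have hβ' : (0 : ℝ) < β := by exact_mod_cast hβ
  rw [abs_le] at hx
  -- The bounds σ ≥ 3 and |Re x| ≤ 2 leave Re(σ - x) ≥ 1, which keeps the segment of integration
  -- away from the poles.
  apply AskeyWilson.intervalIntegrable_phiIntegrand τ.im_pos hτ <;> simp <;> linarith
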